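/- Let $R$ be an associative ring with unity; modules are left $R$-modules and complexes $X=(\cdots\to X_{l+1}\to X_l\to X_{l-1}\to\cdots)$, $l\in\mathbb Z$, are complexes of left $R$-modules, graded homologically. Infima and suprema are taken in $\{-\infty\}\cup\mathbb Z\cup\{\infty\}$, with $\inf\emptyset=\infty$ and $\sup\emptyset=-\infty$. A complex $T$ is totally $\mathcal F$-acyclic if it is an exact complex of projective modules and $\operatorname{Hom}_R(T,F)$ is exact for every flat module $F$. A module $M$ is Ding projective if $M\cong\operatorname{Coker}(T_1\to T_0)$ for some totally $\mathcal F$-acyclic complex $T$. A complex $P$ is DG-projective if every $P_l$ is projective and $\operatorname{Hom}_R(P,E)$ is exact for every exact complex $E$. An $\mathcal F$-complete resolution of a complex $X$ is a diagram of morphisms of complexes $T\xrightarrow{\tau}P\xrightarrow{\pi}X$ where $P$ is DG-projective, $\pi$ is a quasi-isomorphism, $T$ is totally $\mathcal F$-acyclic, and $\tau_i$ is bijective for all $i\gg0$. The Ding projective dimension of $X$ is \[ \mathrm{Dpd}_R(X)=\inf\{\,n\in\mathbb Z \mid \text{there is an } \mathcal F\text{-complete resolution } T\xrightarrow{\tau}P\xrightarrow{\pi}X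 \text{ with } \tau_i \text{ bijective for each } i\ge n\,\}. \] Proposition. Let $X$ be a complex that is homologically bounded below, i.e. $H_l(X)=0$ for all $l\ll0$. Then \[ \mathrm{Dpd}_R(X)=\inf\bigl\{\,\sup\{l\in\mathbb Z\mid Q_l\neq0\}\ \bigm|\ Q\simeq X \text{ and } Q \text{ is a bounded below complex of Ding projective modules}\,\bigr\}, \] where $Q$ is bounded below if $Q_l=0$ for all $l\ll0$, and $Q\simeq X$ means that $Q$ and $X$ are linked by a finite zigzag of quasi-isomorphisms. -/

import Mathlib

open CategoryTheory CategoryTheory.Limits TensorProduct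

universe u

noncomputable section

namespace DingProj

/-! ### Flat modules over an associative ring -/

section Flat

variable (R : Type u) [Ring R]

/-- The subgroup of `N ⊗_ℤ M` generated by the elements `(n r) ⊗ m - n ⊗ (r m)`, for a right
`R`-module `N` (that is, a module over the opposite ring) and a left `R`-module `M`. -/
def balancedRelations (N M : Type u) [AddCommGroup N] [Module Rᵐᵒᵖ N] [AddCommGroup M]
    [Module R M] : AddSubgroup (N ⊗[ℤ] M) :=
  AddSubgroup.closure {t | ∃ (n : N) (r : R) (m : M),
    t = (MulOpposite.op r • n) ⊗ₜ[ℤ] m - n ⊗ₜ[ℤ] (r • m)}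

/-- The tensor product `N ⊗_R M` (an abelian group) of a right `R`-module `N` and a left
`R`-module `M`. -/
abbrev BalancedTensor (N M : Type u) [AddCommGroup N] [Module Rᵐᵒᵖ N] [AddCommGroup M]
    [Module R M] : Type u :=
  (N ⊗[ℤ] M) ⧸ balancedRelations R N M

/-- For a homomorphism `f : N → N'` of right `R`-modules, the induced homomorphism
`f ⊗_R M : N ⊗_R M → N' ⊗_R M`. -/
def balancedTensorMap {N N' : Type u} [AddCommGroup N] [Module Rᵐᵒᵖ N] [AddCommGroup N']
    [Module Rᵐᵒᵖ N'] (f : N →ₗ[Rᵐᵒᵖ] N') (M : Type u) [AddCommGroup M] [Module R M] :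
    BalancedTensor R N M →+ BalancedTensor R N' M :=
  QuotientAddGroup.map (balancedRelations R N M) (balancedRelations R N' M)
    (LinearMap.rTensor M f.toAddMonoidHom.toIntLinearMap).toAddMonoidHom (by
      refine (AddSubgroup.closure_le _).2 ?_
      rintro _ ⟨n, r, m, rfl⟩
      refine AddSubgroup.subset_closure ⟨f n, r, m, ?_⟩
      simp)

/-- A left `R`-module `M` is flat if `- ⊗_R M` preserves injectivity of homomorphisms of right
`R`-modules. -/
def IsFlat (M : Type u) [AddCommGroup M] [Module R M] : Prop :=
  ∀ (N N' : Type u) [AddCommGroup N] [Module Rᵐᵒᵖ N] [AddCommGroup N'] [Module Rᵐᵒᵖ N']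
    (f : N →ₗ[Rᵐᵒᵖ] N'), Function.Injective f → Function.Injective (balancedTensorMap R f M)

end Flat

/-! ### Complexes of left modules, in homological degrees -/

variable {R : Type u} [Ring R]

variable (R) in
/-- Complexes of left `R`-modules. Mathlib's cochain complexes are used, with the usual convention
`X_l = X^{-l}`; the definitions below are stated in the homological degrees `l`. -/
abbrev RComplex : Type (u + 1) := CochainComplex (ModuleCat.{u} R) ℤ

/-- The module `X_l` in homological degree `l`. -/
abbrev comp (X : RComplex R) (l : ℤ) : ModuleCat.{u} R := X.X (-l)

/-- The differential `X_i → X_j`; it is the boundary map if `j = i - 1` (and zero otherwise). -/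
abbrev bdry (X : RComplex R) (i j : ℤ) : comp X i ⟶ comp X j := X.d (-i) (-j)

/-- The component `X_l → Y_l` of a morphism of complexes. -/
abbrev compMap {X Y : RComplex R} (f : X ⟶ Y) (l : ℤ) : comp X l ⟶ comp Y l := f.f (-l)

/-- The homology module `H_l(X)`. -/
abbrev homol (X : RComplex R) (l : ℤ) : ModuleCat.{u} R := X.homology (-l)

/-- `C_l(X) = Coker (X_{l+1} → X_l)`. -/
abbrev coker (X : RComplex R) (l : ℤ) : ModuleCat.{u} R := cokernel (bdry X (l + 1) l)

/-- `X` is bounded below: `X_l = 0` for all `l ≪ 0`. -/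
def IsBoundedBelow (X : RComplex R) : Prop := ∃ b : ℤ, ∀ l < b, IsZero (comp X l)

/-- `X` is homologically bounded below: `H_l(X) = 0` for all `l ≪ 0`. -/
def IsHomologicallyBoundedBelow (X : RComplex R) : Prop := ∃ b : ℤ, ∀ l < b, IsZero (homol X l)

/-- `X ≃ Y`: the two complexes are linked by a finite zigzag of quasi-isomorphisms. -/
def QIsoEquiv (X Y : RComplex R) : Prop :=
  Relation.EqvGen (fun A B : RComplex R => ∃ f : A ⟶ B, QuasiIso f) X Y

/-- `P` is DG-projective: it consists of projective modules and the complex `Hom_R(P, E)` is exact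
for every exact complex `E`. -/
def IsDGProjective (P : RComplex R) : Prop :=
  (∀ l : ℤ, Projective (comp P l)) ∧
    ∀ E : RComplex R, E.Acyclic → (CochainComplex.HomComplex P E).Acyclic

/-- `T` is totally `ℱ`-acyclic, `ℱ` being the class of flat modules: an exact complex of projective
modules such that `Hom_R(T, F)` is exact for every flat module `F`. -/
structure IsTotallyFlatAcyclic (T : RComplex R) : Prop where
  projective : ∀ l : ℤ, Projective (comp T l)
  exact : T.Acyclic
  hom_exact : ∀ F : ModuleCat.{u} R, IsFlat R F → ∀ l : ℤ,
    Function.Exact (fun g : comp T (l - 1) ⟶ F => bdry T l (l - 1) ≫ g)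
      (fun g : comp T l ⟶ F => bdry T (l + 1) l ≫ g)

/-- `M` is Ding projective (strongly Gorenstein flat): `M ≅ C_0(T)` for some totally
`ℱ`-acyclic complex `T`. -/
def IsDingProjective (M : ModuleCat.{u} R) : Prop :=
  ∃ T : RComplex R, IsTotallyFlatAcyclic T ∧ Nonempty (M ≅ coker T 0)

/-- The diagram `T → P → X` is an `ℱ`-complete resolution of `X`: `P → X` is a DG-projective
resolution, `T` is totally `ℱ`-acyclic, and `τ_i` is bijective for all `i ≫ 0`. -/
structure IsFlatCompleteResolution {T P X : RComplex R} (τ : T ⟶ P) (π : P ⟶ X) : Prop where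
  dgProjective : IsDGProjective P
  quasiIso : QuasiIso π
  totallyAcyclic : IsTotallyFlatAcyclic T
  bijective : ∃ N : ℤ, ∀ i ≥ N, Function.Bijective (compMap τ i)

/-- The extended integers `{-∞} ∪ ℤ ∪ {∞}`, a complete linear order; so `inf ∅ = ∞` and
`sup ∅ = -∞`. -/
abbrev ExtInt : Type := WithBot (WithTop ℤ)

/-- An integer as an extended integer. -/
abbrev ofInt (n : ℤ) : ExtInt := ((n : WithTop ℤ) : WithBot (WithTop ℤ))

/-- The Ding projective dimension of `X`: the infimum of the integers `n` for which there is an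
`ℱ`-complete resolution `T → P → X` with `τ_i : T_i → P_i` bijective for each `i ≥ n`. -/
def Dpd (X : RComplex R) : ExtInt :=
  sInf (ofInt '' {n : ℤ | ∃ (T P : RComplex R) (τ : T ⟶ P) (π : P ⟶ X),
    IsFlatCompleteResolution τ π ∧ ∀ i ≥ n, Function.Bijective (compMap τ i)})

/-- `sup {l ∈ ℤ | Q_l ≠ 0}`. -/
def supDegree (Q : RComplex R) : ExtInt :=
  sSup (ofInt '' {l : ℤ | ¬ IsZero (comp Q l)})

end DingProj

end

/-! Homological degree `l` is cohomological degree `-l`, so bounds below become bounds above. The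
key is an intrinsic form of Ding projectivity (`isDingProjective_iff`): all higher Ext into flat
modules vanish, and the module embeds in a projective with cokernel of the same kind. This class
contains the projectives and is closed under extensions and kernels of epimorphisms.

Let `Q` vanish in degrees below `m`, and let `P → Q` be a bounded above projective resolution. Its
mapping cone is an acyclic bounded above complex of Ding projectives, so each quotient by
coboundaries is Ding projective; as `Q^(m-1) = 0`, one of these is `P^m / B^m`. Splicing `P` in
degrees at most `m` with a projective coresolution of `P^m / B^m` gives `T`
(`exists_totallyFlatAcyclic`), and K-projectivity of `P` turns the zigzag from `Q` to `X` into a map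
`P → X`.

Conversely, if `T → P` is bijective in degrees at most `m`, then `P` is exact below `m` and `P^m /
B^m` is Ding projective. The homology of `P` vanishes in high degrees, so its cycles there are
projective (`projective_cycles`); truncating `P` above at such cycles and below at `P^m / B^m` gives
`Q`. -/

noncomputable section

namespace DingProj

/-! ### Projective modules are flat -/

section ProjectiveFlat

variable {R : Type u} [Ring R] {M : Type u} [AddCommGroup M] [Module R M]

/-- The homomorphism `N ⊗_R M → N^(M)` induced by a homomorphism `s : M → R^(M)`. -/
def balancedTensorToFinsupp (s : M →ₗ[R] (M →₀ R)) (N : Type u) [AddCommGroup N]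
    [Module Rᵐᵒᵖ N] : BalancedTensor R N M →+ (M →₀ N) :=
  QuotientAddGroup.lift (balancedRelations R N M)
    (TensorProduct.liftAddHom
      (AddMonoidHom.mk' (fun n => AddMonoidHom.mk' (fun m =>
          (s m).mapRange (fun r => MulOpposite.op r • n) (by simp))
        (fun m m' => by ext p; simp [add_smul]))
        (fun n n' => by ext m p; simp))
      (fun k n m => by
        ext p
        change MulOpposite.op (s m p) • (k • n) = MulOpposite.op (s (k • m) p) • n
        rw [map_zsmul, Finsupp.smul_apply, MulOpposite.op_smul, smul_assoc]
        exact map_zsmul (DistribSMul.toAddMonoidHom N (MulOpposite.op (s m p))) k n))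
    (by
      refine (AddSubgroup.closure_le _).2 ?_
      rintro _ ⟨n, r, m, rfl⟩
      simp only [SetLike.mem_coe, AddMonoidHom.mem_ker, map_sub, sub_eq_zero]
      ext p
      simp [mul_smul])

lemma balancedTensorToFinsupp_mk (s : M →ₗ[R] (M →₀ R)) {N : Type u} [AddCommGroup N]
    [Module Rᵐᵒᵖ N] (n : N) (m : M) :
    balancedTensorToFinsupp s N (QuotientAddGroup.mk (n ⊗ₜ[ℤ] m)) =
      (s m).mapRange (fun r => MulOpposite.op r • n) (by simp) := rfl

lemma balancedTensor_induction {N : Type u} [AddCommGroup N] [Module Rᵐᵒᵖ N]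
    {p : BalancedTensor R N M → Prop} (h0 : p 0)
    (ht : ∀ (n : N) (m : M), p (QuotientAddGroup.mk (n ⊗ₜ[ℤ] m)))
    (ha : ∀ x y, p x → p y → p (x + y)) (x : BalancedTensor R N M) : p x := by
  induction x using QuotientAddGroup.induction_on with
  | H t =>
    induction t using TensorProduct.induction_on with
    | zero => exact h0
    | tmul n m => exact ht n m
    | add a b iha ihb => exact ha _ _ iha ihb

lemma balancedTensor_smul_tmul {N : Type u} [AddCommGroup N] [Module Rᵐᵒᵖ N]
    (n : N) (r : R) (m : M) :
    (QuotientAddGroup.mk ((MulOpposite.op r • n) ⊗ₜ[ℤ] m) : BalancedTensor R N M) =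
      QuotientAddGroup.mk (n ⊗ₜ[ℤ] (r • m)) := by
  rw [← sub_eq_zero, ← QuotientAddGroup.mk_sub, QuotientAddGroup.eq_zero_iff]
  exact AddSubgroup.subset_closure ⟨n, r, m, rfl⟩

/-- Since `s` splits `R^(M) → M`, a left inverse is `N^(M) → N ⊗_R M`, sending `n` in position `m`
to `n ⊗ m`. -/
lemma balancedTensorToFinsupp_injective (s : M →ₗ[R] (M →₀ R))
    (hs : (Finsupp.linearCombination R id) ∘ₗ s = LinearMap.id) (N : Type u) [AddCommGroup N]
    [Module Rᵐᵒᵖ N] : Function.Injective (balancedTensorToFinsupp s N) := by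
  let ψ : (M →₀ N) →+ BalancedTensor R N M :=
    Finsupp.liftAddHom (fun m => AddMonoidHom.mk' (fun n => QuotientAddGroup.mk (n ⊗ₜ[ℤ] m))
      (fun n n' => by rw [TensorProduct.add_tmul]; rfl))
  have key : ∀ x, ψ (balancedTensorToFinsupp s N x) = x := by
    intro x
    induction x using balancedTensor_induction with
    | h0 => simp
    | ha x y hx hy => rw [map_add, map_add, hx, hy]
    | ht n m =>
      rw [balancedTensorToFinsupp_mk]
      have hm : ((s m).sum fun p r => r • p) = m := by
        simpa [Finsupp.linearCombination_apply] using LinearMap.congr_fun hs m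
      conv_rhs => rw [← hm]
      simp only [ψ, Finsupp.liftAddHom_apply]
      rw [Finsupp.sum_mapRange_index (by simp)]
      simp only [AddMonoidHom.mk'_apply, balancedTensor_smul_tmul]
      simp only [Finsupp.sum, TensorProduct.tmul_sum]
      exact (map_sum (QuotientAddGroup.mk' (balancedRelations R N M)) _ _).symm
  exact Function.LeftInverse.injective key

lemma isFlat_of_projective [Module.Projective R M] : IsFlat R M := by
  intro N N' _ _ _ _ f hf
  obtain ⟨s, hs⟩ := (Module.projective_def' (R := R) (P := M)).1 inferInstance
  have nat : ∀ x, balancedTensorToFinsupp s N' (balancedTensorMap R f M x) =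
      (balancedTensorToFinsupp s N x).mapRange f (map_zero f) := by
    intro x
    induction x using balancedTensor_induction with
    | h0 => simp
    | ha x y hx hy => rw [map_add, map_add, map_add, hx, hy, Finsupp.mapRange_add (map_add f)]
    | ht n m =>
      change balancedTensorToFinsupp s N' (QuotientAddGroup.mk (f n ⊗ₜ[ℤ] m)) = _
      rw [balancedTensorToFinsupp_mk, balancedTensorToFinsupp_mk]
      ext p
      simp
  refine Function.Injective.of_comp (f := balancedTensorToFinsupp s N') ?_
  have : balancedTensorToFinsupp s N' ∘ balancedTensorMap R f M =
      Finsupp.mapRange f (map_zero f) ∘ balancedTensorToFinsupp s N := funext nat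
  rw [this]
  exact (Finsupp.mapRange_injective f (map_zero f) hf).comp
    (balancedTensorToFinsupp_injective s hs N)

end ProjectiveFlat

variable {R : Type u} [Ring R]

lemma isFlat_of_categorical_projective (M : ModuleCat.{u} R) [Projective M] : IsFlat R M :=
  have : Module.Projective R M := (IsProjective.iff_projective M).2 inferInstance
  isFlat_of_projective

/-! ### Dimension shifting for Ext; exact sequences of cokernels -/

section Abelian

variable {C : Type*} [Category* C] [Abelian C]

/-- In a short exact sequence, if `Ext^n` into `Y` vanishes on the outer terms, it vanishes on the
middle term. -/
lemma ext_eq_zero_of_shortExact [HasExt C] {S : ShortComplex C} (hS : S.ShortExact) {Y : C} {n : ℕ}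
    (h₁ : ∀ e : Abelian.Ext S.X₁ Y n, e = 0) (h₃ : ∀ e : Abelian.Ext S.X₃ Y n, e = 0)
    (e : Abelian.Ext S.X₂ Y n) : e = 0 := by
  obtain ⟨x, rfl⟩ := Abelian.Ext.contravariant_sequence_exact₂ hS Y e (h₁ _)
  rw [h₃ x, Abelian.Ext.comp_zero]

lemma ext_eq_zero_of_shortExact_left [HasExt C] {S : ShortComplex C} (hS : S.ShortExact) {Y : C}
    {n : ℕ} (h₂ : ∀ e : Abelian.Ext S.X₂ Y n, e = 0)
    (h₃ : ∀ e : Abelian.Ext S.X₃ Y (n + 1), e = 0) (e : Abelian.Ext S.X₁ Y n) : e = 0 := by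
  obtain ⟨x, rfl⟩ := Abelian.Ext.contravariant_sequence_exact₁ hS Y e (add_comm 1 n) (h₃ _)
  rw [h₂ x, Abelian.Ext.comp_zero]

lemma ext_eq_zero_of_shortExact_right [HasExt C] {S : ShortComplex C} (hS : S.ShortExact) {Y : C}
    {n : ℕ} (h₂ : ∀ e : Abelian.Ext S.X₂ Y (n + 1), e = 0)
    (h₁ : ∀ e : Abelian.Ext S.X₁ Y n, e = 0) (e : Abelian.Ext S.X₃ Y (n + 1)) : e = 0 := by
  obtain ⟨x, rfl⟩ := Abelian.Ext.contravariant_sequence_exact₃ hS Y e (h₂ _) (add_comm 1 n)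
  rw [h₁ x, Abelian.Ext.comp_zero]

lemma ext_eq_zero_of_iso [HasExt C] {X X' Y : C} (i : X ≅ X') {n : ℕ}
    (h : ∀ e : Abelian.Ext X Y n, e = 0) (e : Abelian.Ext X' Y n) : e = 0 := by
  have h1 : (Abelian.Ext.mk₀ (i.inv ≫ i.hom)).comp e (zero_add n) = e := by
    rw [i.inv_hom_id, Abelian.Ext.mk₀_id_comp]
  rw [← h1, ← Abelian.Ext.mk₀_comp_mk₀, Abelian.Ext.comp_assoc_of_second_deg_zero,
    h ((Abelian.Ext.mk₀ i.hom).comp e (zero_add n)), Abelian.Ext.comp_zero]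

/-- If `Ext^1(X₃, Y) = 0`, morphisms `X₁ ⟶ Y` extend to `X₂`. -/
lemma exists_extension_of_ext_one_eq_zero [HasExt C] {S : ShortComplex C} (hS : S.ShortExact)
    {Y : C} (h : ∀ e : Abelian.Ext S.X₃ Y 1, e = 0) (f : S.X₁ ⟶ Y) : ∃ g, S.f ≫ g = f := by
  obtain ⟨x, hx⟩ := Abelian.Ext.contravariant_sequence_exact₁ hS Y (Abelian.Ext.mk₀ f)
    (add_zero 1) (h _)
  obtain ⟨g, rfl⟩ := Abelian.Ext.homEquiv₀.symm.surjective x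
  refine ⟨g, Abelian.Ext.homEquiv₀.symm.injective ?_⟩
  simpa using hx

/-- If `X₂` is projective and morphisms `X₁ ⟶ Y` extend to `X₂`, then `Ext^1(X₃, Y) = 0`. -/
lemma ext_one_eq_zero_of_extension [HasExt C] {S : ShortComplex C} (hS : S.ShortExact) {Y : C}
    [Projective S.X₂] (h : ∀ f : S.X₁ ⟶ Y, ∃ g, S.f ≫ g = f) (e : Abelian.Ext S.X₃ Y 1) :
    e = 0 := by
  obtain ⟨x, rfl⟩ := Abelian.Ext.contravariant_sequence_exact₃ hS Y e
    (Abelian.Ext.eq_zero_of_projective _) (add_zero 1)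
  obtain ⟨f, rfl⟩ := Abelian.Ext.homEquiv₀.symm.surjective x
  obtain ⟨g, rfl⟩ := h f
  have := Abelian.Ext.mk₀_comp_mk₀ S.f g
  dsimp [Abelian.Ext.homEquiv₀]
  rw [← this, hS.extClass_comp_assoc]

/-- The connecting morphism starts at `I.L₀.X₃ = 0`, so exactness of the snake sequence makes the
first map mono. -/
lemma snakeInput_shortExact_L₃ (I : ShortComplex.SnakeInput C) (hz : IsZero I.L₀.X₃)
    [Epi I.L₂.g] : I.L₃.ShortExact := by
  have hf := I.L₂'_exact.mono_g (hz.eq_of_src _ _)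
  have : Epi I.v₂₃.τ₃ := inferInstance
  have : Epi (I.v₂₃.τ₂ ≫ I.L₃.g) := by
    rw [I.v₂₃.comm₂₃]
    infer_instance
  exact { exact := I.L₃_exact
          mono_f := hf
          epi_g := epi_of_epi I.v₂₃.τ₂ _ }

/-- A morphism of short exact sequences which is a monomorphism on the left and on the right is a
monomorphism in the middle, and its cokernels form a short exact sequence. -/
lemma shortExact_cokernel {S T : ShortComplex C} (hS : S.ShortExact) (hT : T.ShortExact)
    (φ : S ⟶ T) [Mono φ.τ₁] [Mono φ.τ₃] :
    Mono φ.τ₂ ∧ ∃ (f : cokernel φ.τ₁ ⟶ cokernel φ.τ₂) (g : cokernel φ.τ₂ ⟶ cokernel φ.τ₃)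
      (w : f ≫ g = 0), (ShortComplex.mk f g w).ShortExact := by
  have := hT.epi_g
  have hm : Mono φ.τ₂ := by
    have := hS.mono_f
    have := hT.mono_f
    refine Preadditive.mono_of_cancel_zero _ fun x hx => ?_
    have h₃ : x ≫ S.g = 0 := by
      rw [← cancel_mono φ.τ₃, Category.assoc, ← φ.comm₂₃, reassoc_of% hx, zero_comp, zero_comp]
    have h₁ : hS.exact.lift x h₃ = 0 := by
      rw [← cancel_mono φ.τ₁, ← cancel_mono T.f, Category.assoc, φ.comm₁₂,
        hS.exact.lift_f_assoc, hx, zero_comp, zero_comp]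
    rw [← hS.exact.lift_f x h₃, h₁, zero_comp]
  let I : ShortComplex.SnakeInput C :=
    { L₀ := kernel φ
      L₁ := S
      L₂ := T
      L₃ := cokernel φ
      v₀₁ := kernel.ι φ
      v₁₂ := φ
      v₂₃ := cokernel.π φ
      h₀ := kernelIsKernel φ
      h₃ := cokernelIsCokernel φ
      L₁_exact := hS.exact
      epi_L₁_g := hS.epi_g
      L₂_exact := hT.exact
      mono_L₂_f := hT.mono_f }
  have hse : I.L₃.ShortExact := snakeInput_shortExact_L₃ I
    ((isZero_kernel_of_mono φ.τ₃).of_iso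
      (I.h₀τ₃.conePointUniqueUpToIso (limit.isLimit _)))
  let e₁ : I.L₃.X₁ ≅ cokernel φ.τ₁ := I.h₃τ₁.coconePointUniqueUpToIso (colimit.isColimit _)
  let e₂ : I.L₃.X₂ ≅ cokernel φ.τ₂ := I.h₃τ₂.coconePointUniqueUpToIso (colimit.isColimit _)
  let e₃ : I.L₃.X₃ ≅ cokernel φ.τ₃ := I.h₃τ₃.coconePointUniqueUpToIso (colimit.isColimit _)
  exact ⟨hm, e₁.inv ≫ I.L₃.f ≫ e₂.hom, e₂.inv ≫ I.L₃.g ≫ e₃.hom, by simp,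
    ShortComplex.shortExact_of_iso (ShortComplex.isoMk e₁ e₂ e₃ (by simp) (by simp)) hse⟩

lemma shortExact_cokernel_comp {X Y Z : C} (f : X ⟶ Y) (g : Y ⟶ Z) [Mono g] :
    ∃ (a : cokernel f ⟶ cokernel (f ≫ g)) (b : cokernel (f ≫ g) ⟶ cokernel g) (w : a ≫ b = 0),
      (ShortComplex.mk a b w).ShortExact :=
  have : Epi (kernelCokernelCompSequence.snakeInput f g).L₂.g :=
    inferInstanceAs (Epi (biprod.snd : Y ⊞ Z ⟶ Z))
  ⟨_, _, _, snakeInput_shortExact_L₃ (kernelCokernelCompSequence.snakeInput f g)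
    (isZero_kernel_of_mono g)⟩

end Abelian

/-! ### Ding projectivity through orthogonality and coresolutions -/

/-- `Ext^i(M, F) = 0` for every `i > 0` and every flat module `F`. -/
def FlatOrthogonal (M : ModuleCat.{u} R) : Prop :=
  ∀ F : ModuleCat.{u} R, IsFlat R F → ∀ (i : ℕ) (e : Abelian.Ext M F (i + 1)), e = 0

lemma FlatOrthogonal.of_projective (M : ModuleCat.{u} R) [Projective M] : FlatOrthogonal M :=
  fun _ _ _ e => Abelian.Ext.eq_zero_of_projective e

lemma FlatOrthogonal.of_iso {M N : ModuleCat.{u} R} (hM : FlatOrthogonal M) (i : M ≅ N) :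
    FlatOrthogonal N :=
  fun F hF n => ext_eq_zero_of_iso i (hM F hF n)

lemma FlatOrthogonal.middle {S : ShortComplex (ModuleCat.{u} R)} (hS : S.ShortExact)
    (h₁ : FlatOrthogonal S.X₁) (h₃ : FlatOrthogonal S.X₃) : FlatOrthogonal S.X₂ :=
  fun F hF n => ext_eq_zero_of_shortExact hS (h₁ F hF n) (h₃ F hF n)

lemma FlatOrthogonal.left {S : ShortComplex (ModuleCat.{u} R)} (hS : S.ShortExact)
    (h₂ : FlatOrthogonal S.X₂) (h₃ : FlatOrthogonal S.X₃) : FlatOrthogonal S.X₁ :=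
  fun F hF n => ext_eq_zero_of_shortExact_left hS (h₂ F hF n) (h₃ F hF (n + 1))

/-- `M` belongs to a class of modules which are left orthogonal to flat modules, and which embed
into projective modules with cokernel in the class. -/
def DingCoresolvable (M : ModuleCat.{u} R) : Prop :=
  ∃ S : ModuleCat.{u} R → Prop, S M ∧ ∀ N, S N → FlatOrthogonal N ∧
    ∃ (P N' : ModuleCat.{u} R) (i : N ⟶ P) (p : P ⟶ N') (w : i ≫ p = 0),
      (ShortComplex.mk i p w).ShortExact ∧ Projective P ∧ S N'

namespace DingCoresolvable

lemma flatOrthogonal {M : ModuleCat.{u} R} (hM : DingCoresolvable M) : FlatOrthogonal M := by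
  obtain ⟨S, hSM, hS⟩ := hM
  exact (hS M hSM).1

lemma exists_shortExact {M : ModuleCat.{u} R} (hM : DingCoresolvable M) :
    ∃ (P N' : ModuleCat.{u} R) (i : M ⟶ P) (p : P ⟶ N') (w : i ≫ p = 0),
      (ShortComplex.mk i p w).ShortExact ∧ Projective P ∧ DingCoresolvable N' := by
  obtain ⟨S, hSM, hS⟩ := hM
  obtain ⟨_, P, N', i, p, w, h, hP, hN'⟩ := hS M hSM
  exact ⟨P, N', i, p, w, h, hP, S, hN', hS⟩

/-- The definition is coinductive: the witnessing class is enlarged by `M` itself. -/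
lemma of_shortExact {M : ModuleCat.{u} R} (hM : FlatOrthogonal M) {P N' : ModuleCat.{u} R}
    {i : M ⟶ P} {p : P ⟶ N'} (w : i ≫ p = 0) (h : (ShortComplex.mk i p w).ShortExact)
    (hP : Projective P) (hN' : DingCoresolvable N') : DingCoresolvable M := by
  refine ⟨fun N => N = M ∨ DingCoresolvable N, Or.inl rfl, ?_⟩
  rintro N (rfl | hN)
  · exact ⟨hM, P, N', i, p, w, h, hP, Or.inr hN'⟩
  · obtain ⟨P, N', i, p, w, h, hP, hN'⟩ := hN.exists_shortExact
    exact ⟨hN.flatOrthogonal, P, N', i, p, w, h, hP, Or.inr hN'⟩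

lemma of_projective (M : ModuleCat.{u} R) [Projective M] : DingCoresolvable M := by
  refine ⟨fun N => Projective N, inferInstance, fun N hN => ⟨.of_projective N, N, ModuleCat.of R PUnit, 𝟙 N, 0,
    by simp, ?_, hN, inferInstance⟩⟩
  exact { exact := (ShortComplex.exact_iff_epi _ rfl).2 (by dsimp; infer_instance)
          mono_f := by dsimp; infer_instance
          epi_g := (ModuleCat.isZero_of_subsingleton _).epi _ }

lemma of_iso {M N : ModuleCat.{u} R} (hM : DingCoresolvable M) (e : M ≅ N) :
    DingCoresolvable N := by
  obtain ⟨P, N', i, p, w, h, hP, hN'⟩ := hM.exists_shortExact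
  refine of_shortExact (hM.flatOrthogonal.of_iso e) (i := e.inv ≫ i) (p := p) (by simp [w])
    ?_ hP hN'
  exact ShortComplex.shortExact_of_iso (ShortComplex.isoMk (S₁ := .mk i p w)
    (S₂ := .mk (e.inv ≫ i) p (by simp [w])) e (Iso.refl _) (Iso.refl _) (by simp) (by simp)) h

lemma of_mono {M P : ModuleCat.{u} R} (hM : FlatOrthogonal M) (i : M ⟶ P) [Mono i]
    (hP : Projective P) (h : DingCoresolvable (cokernel i)) : DingCoresolvable M :=
  of_shortExact hM (cokernel.condition i) { exact := ShortComplex.exact_cokernel i } hP h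

lemma exists_mono {M : ModuleCat.{u} R} (hM : DingCoresolvable M) :
    ∃ (P : ModuleCat.{u} R) (i : M ⟶ P), Projective P ∧ Mono i ∧
      DingCoresolvable (cokernel i) := by
  obtain ⟨P, N', i, p, w, h, hP, hN'⟩ := hM.exists_shortExact
  exact ⟨P, i, hP, h.mono_f, hN'.of_iso
    (h.gIsCokernel.coconePointUniqueUpToIso (colimit.isColimit _))⟩

/-- A horseshoe argument. The projective `P` is flat, so `Ext^1(B, P) = 0` and `A ⟶ P` extends to
`N`; thus `N` embeds in `P ⊞ Q`, with cokernel again an extension of two modules of the class. The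
extensions therefore form a witnessing class. -/
lemma middle {S : ShortComplex (ModuleCat.{u} R)} (hS : S.ShortExact)
    (h₁ : DingCoresolvable S.X₁) (h₃ : DingCoresolvable S.X₃) : DingCoresolvable S.X₂ := by
  refine ⟨fun N => ∃ (A B : ModuleCat.{u} R) (f : A ⟶ N) (g : N ⟶ B) (w : f ≫ g = 0),
    (ShortComplex.mk f g w).ShortExact ∧ DingCoresolvable A ∧ DingCoresolvable B,
    ⟨_, _, S.f, S.g, S.zero, hS, h₁, h₃⟩, ?_⟩
  rintro N ⟨A, B, f, g, w, h, hA, hB⟩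
  refine ⟨FlatOrthogonal.middle h hA.flatOrthogonal hB.flatOrthogonal, ?_⟩
  obtain ⟨P, i, hP, _, hi⟩ := hA.exists_mono
  obtain ⟨Q, j, hQ, _, hj⟩ := hB.exists_mono
  obtain ⟨u, hu⟩ := exists_extension_of_ext_one_eq_zero h
    (hB.flatOrthogonal P (isFlat_of_categorical_projective P) 0) i
  dsimp at u hu
  let φ : ShortComplex.mk f g w ⟶ ShortComplex.mk (biprod.inl : P ⟶ P ⊞ Q) biprod.snd (by simp) :=
    { τ₁ := i
      τ₂ := biprod.lift u (g ≫ j)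
      τ₃ := j
      comm₁₂ := by
        apply biprod.hom_ext <;> simp [hu, reassoc_of% w]
      comm₂₃ := by simp }
  have : Mono φ.τ₁ := by assumption
  have : Mono φ.τ₃ := by assumption
  obtain ⟨hm, a, b, w', hab⟩ := shortExact_cokernel h
    (ShortComplex.Splitting.ofHasBinaryBiproduct P Q).shortExact φ
  exact ⟨P ⊞ Q, cokernel φ.τ₂, φ.τ₂, cokernel.π _, cokernel.condition _,
    { exact := ShortComplex.exact_cokernel _ }, inferInstance, _, _, a, b, w', hab, hi, hj⟩

/-- Embed `S.X₂` in a projective `P`; the cokernel of `S.X₁ ⟶ P` is an extension of `cokernel i` by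
`S.X₃`, so `middle` applies to it. -/
lemma left {S : ShortComplex (ModuleCat.{u} R)} (hS : S.ShortExact)
    (h₂ : DingCoresolvable S.X₂) (h₃ : DingCoresolvable S.X₃) : DingCoresolvable S.X₁ := by
  have := hS.mono_f
  obtain ⟨P, i, hP, _, hi⟩ := h₂.exists_mono
  obtain ⟨a, b, w, h⟩ := shortExact_cokernel_comp S.f i
  refine of_mono (FlatOrthogonal.left hS h₂.flatOrthogonal h₃.flatOrthogonal) (S.f ≫ i) hP ?_
  exact middle h (h₃.of_iso (hS.gIsCokernel.coconePointUniqueUpToIso (colimit.isColimit _))) hi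

lemma of_isZero {M : ModuleCat.{u} R} (hM : IsZero M) : DingCoresolvable M :=
  have := hM.projective
  of_projective M

lemma biprod {M N : ModuleCat.{u} R} (hM : DingCoresolvable M) (hN : DingCoresolvable N) :
    DingCoresolvable (M ⊞ N) :=
  middle (ShortComplex.Splitting.ofHasBinaryBiproduct M N).shortExact hM hN

end DingCoresolvable

/-! ### Splicing short exact sequences -/

section Splice

variable {C : Type*} [Category* C] [Abelian C]

/-- The complex obtained by splicing a family of short complexes along isomorphisms. -/
abbrev splice (s : ℤ → ShortComplex C) (e : ∀ j, (s j).X₃ ≅ (s (j + 1)).X₁) : CochainComplex C ℤ :=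
  CochainComplex.of (fun j => (s j).X₂) (fun j => (s j).g ≫ (e j).hom ≫ (s (j + 1)).f)
    (fun j => by simp)

variable (s : ℤ → ShortComplex C) (e : ∀ j, (s j).X₃ ≅ (s (j + 1)).X₁)

lemma splice_d (j : ℤ) : (splice s e).d j (j + 1) = (s j).g ≫ (e j).hom ≫ (s (j + 1)).f :=
  CochainComplex.of_d (fun j => (s j).X₂) (fun j => (s j).g ≫ (e j).hom ≫ (s (j + 1)).f) j

/-- Exactness in the middle is unchanged by composing the first map with an epimorphism and the
second with a monomorphism. -/
lemma splice_acyclic (hs : ∀ j, (s j).ShortExact) : (splice s e).Acyclic := by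
  intro k
  obtain ⟨j, rfl⟩ : ∃ j, k = j + 1 := ⟨k - 1, by simp⟩
  rw [HomologicalComplex.exactAt_iff' _ j (j + 1) (j + 1 + 1) (by simp) (by simp)]
  have := (hs (j + 1)).mono_f
  have := (hs (j + 1 + 1)).mono_f
  have := (hs j).epi_g
  let m : (s (j + 1)).X₃ ⟶ (s (j + 1 + 1)).X₂ := (e (j + 1)).hom ≫ (s (j + 1 + 1)).f
  let p : (s j).X₂ ⟶ (s (j + 1)).X₁ := (s j).g ≫ (e j).hom
  have hp : Epi p := epi_comp _ _
  have hm : Mono m := mono_comp _ _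
  let S₁ : ShortComplex C := ShortComplex.mk (s (j + 1)).f ((s (j + 1)).g ≫ m) (by simp)
  let φ : s (j + 1) ⟶ S₁ := { τ₁ := 𝟙 _, τ₂ := 𝟙 _, τ₃ := m }
  have : Epi φ.τ₁ := inferInstanceAs (Epi (𝟙 _))
  have : IsIso φ.τ₂ := inferInstanceAs (IsIso (𝟙 _))
  have : Mono φ.τ₃ := hm
  have h₁ : S₁.Exact := (ShortComplex.exact_iff_of_epi_of_isIso_of_mono φ).1 (hs (j + 1)).exact
  let ψ : (splice s e).sc' j (j + 1) (j + 1 + 1) ⟶ S₁ :=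
    { τ₁ := p
      τ₂ := 𝟙 _
      τ₃ := 𝟙 _
      comm₁₂ := by
        refine Eq.trans ?_ (Category.comp_id _).symm
        exact (Category.assoc _ _ _).trans (splice_d s e j).symm
      comm₂₃ := by
        refine (Category.id_comp _).trans (Eq.trans ?_ (Category.comp_id _).symm)
        exact (splice_d s e (j + 1)).symm }
  have : Epi ψ.τ₁ := hp
  have : IsIso ψ.τ₂ := inferInstanceAs (IsIso (𝟙 _))
  have : Mono ψ.τ₃ := inferInstanceAs (Mono (𝟙 _))
  exact (ShortComplex.exact_iff_of_epi_of_isIso_of_mono ψ).2 h₁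

/-- A cocycle `g` vanishes on `(s (j + 1)).X₁`, hence descends to `(s (j + 1)).X₃`, from which it
extends to the next middle term. -/
lemma splice_extension (hs : ∀ j, (s j).ShortExact) {F : C}
    (hF : ∀ (j : ℤ) (f : (s j).X₁ ⟶ F), ∃ g, (s j).f ≫ g = f) (j : ℤ)
    (g : (splice s e).X (j + 1) ⟶ F) (hg : (splice s e).d j (j + 1) ≫ g = 0) :
    ∃ h, (splice s e).d (j + 1) (j + 1 + 1) ≫ h = g := by
  have := (hs j).epi_g
  rw [splice_d] at hg ⊢
  let g' : (s (j + 1)).X₂ ⟶ F := g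
  have hg' : (s (j + 1)).f ≫ g' = 0 := by
    rw [← cancel_epi (e j).hom, ← cancel_epi (s j).g]
    simpa [g'] using hg
  have := (hs (j + 1)).epi_g
  obtain ⟨k, hk⟩ : ∃ k : (s (j + 1)).X₃ ⟶ F, (s (j + 1)).g ≫ k = g' :=
    ⟨(hs (j + 1)).gIsCokernel.desc (CokernelCofork.ofπ g' hg'),
      (hs (j + 1)).gIsCokernel.fac (CokernelCofork.ofπ g' hg') WalkingParallelPair.one⟩
  obtain ⟨h, hh⟩ := hF (j + 1 + 1) ((e (j + 1)).inv ≫ k)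
  refine ⟨h, ?_⟩
  change ((s (j + 1)).g ≫ (e (j + 1)).hom ≫ (s (j + 1 + 1)).f) ≫ h = g'
  simp [hh, hk]

end Splice

/-! ### Quotients by coboundaries -/

section Opcycles

variable {C : Type*} [Category* C] [Abelian C] (K : CochainComplex C ℤ)

/-- The short complex `K^i / B^i ⟶ K^j ⟶ K^j / B^j`. -/
@[simps]
def opcyclesShortComplex (i j : ℤ) : ShortComplex C :=
  ShortComplex.mk (K.fromOpcycles i j) (K.pOpcycles j) (by
    rw [← cancel_epi (K.pOpcycles i)]
    simp)

lemma opcyclesShortComplex_shortExact (i j : ℤ) (hij : i + 1 = j) (h : K.ExactAt i) :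
    (opcyclesShortComplex K i j).ShortExact := by
  have hm : Mono (K.fromOpcycles i j) := by
    have hz : IsZero (K.homology i) := h.isZero_homology
    have hx : (ShortComplex.mk (K.homologyι i) (K.fromOpcycles i j) (by simp)).Exact :=
      ShortComplex.exact_of_f_is_kernel _ (K.homologyIsKernel i j (by simp [hij]))
    exact hx.mono_g (hz.eq_of_src _ _)
  have he : (ShortComplex.mk (K.d i j) (K.pOpcycles j) (by simp)).Exact :=
    ShortComplex.exact_of_g_is_cokernel _ (K.opcyclesIsCokernel i j (by simp [← hij]))
  let φ : ShortComplex.mk (K.d i j) (K.pOpcycles j) (by simp) ⟶ opcyclesShortComplex K i j :=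
    { τ₁ := K.pOpcycles i
      τ₂ := 𝟙 _
      τ₃ := 𝟙 _
      comm₁₂ := (K.p_fromOpcycles i j).trans (Category.comp_id _).symm
      comm₂₃ := (Category.id_comp _).trans (Category.comp_id _).symm }
  have : Epi φ.τ₁ := inferInstanceAs (Epi (K.pOpcycles i))
  have : IsIso φ.τ₂ := inferInstanceAs (IsIso (𝟙 _))
  have : Mono φ.τ₃ := inferInstanceAs (Mono (𝟙 _))
  exact { exact := (ShortComplex.exact_iff_of_epi_of_isIso_of_mono φ).1 he
          mono_f := hm
          epi_g := inferInstanceAs (Epi (K.pOpcycles j)) }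

/-- Indices such as `j + 1 - 1` and `j` agree only propositionally, so the equalities are taken as
variables that can be substituted away. -/
lemma exists_opcyclesShortComplex_iso (j i k : ℤ) (hij : j = i) (a b : ShortComplex C) {l : ℤ}
    (ha : a = opcyclesShortComplex K l j) (hb : b = opcyclesShortComplex K i k) :
    ∃ e : a.X₃ ≅ b.X₁, a.g ≫ e.hom ≫ b.f =
      eqToHom (by rw [ha]; rfl) ≫ K.d j k ≫ eqToHom (by rw [hb]; rfl) := by
  subst hij ha hb
  refine ⟨Iso.refl (K.opcycles j), ?_⟩
  change K.pOpcycles j ≫ 𝟙 (K.opcycles j) ≫ K.fromOpcycles j k = 𝟙 (K.X j) ≫ K.d j k ≫ 𝟙 (K.X k)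
  simp

lemma isIso_opcyclesMap {K L : CochainComplex C ℤ} (φ : K ⟶ L) (i j : ℤ) (hij : i + 1 = j)
    [Epi (φ.f i)] [IsIso (φ.f j)] : IsIso (HomologicalComplex.opcyclesMap φ j) := by
  refine ⟨L.descOpcycles (inv (φ.f j) ≫ K.pOpcycles j) i (by simp [← hij]) ?_, ?_, ?_⟩
  · rw [← cancel_epi (φ.f i), φ.comm_assoc]
    simp
  · simp [← cancel_epi (K.pOpcycles j)]
  · simp [← cancel_epi (L.pOpcycles j)]

end Opcycles

/-! ### Totally acyclic complexes and their construction -/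

lemma IsTotallyFlatAcyclic.of_extension {T : RComplex R} (hP : ∀ j, Projective (T.X j))
    (hE : T.Acyclic)
    (hF : ∀ F : ModuleCat.{u} R, IsFlat R F → ∀ (j : ℤ) (g : T.X (j + 1) ⟶ F),
      T.d j (j + 1) ≫ g = 0 → ∃ h, T.d (j + 1) (j + 1 + 1) ≫ h = g) :
    IsTotallyFlatAcyclic T where
  projective l := hP _
  exact := hE
  hom_exact F h l := by
    have key : ∀ i j k : ℤ, i + 1 = j → j + 1 = k → ∀ g : T.X j ⟶ F,
        T.d i j ≫ g = 0 ↔ g ∈ Set.range (fun g : T.X k ⟶ F => T.d j k ≫ g) := by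
      rintro i _ _ rfl rfl g
      refine ⟨fun hg => hF F h i g hg, ?_⟩
      rintro ⟨g, rfl⟩
      simp
    exact key _ _ _ (by ring) (by ring)

lemma IsTotallyFlatAcyclic.exists_extension {T : RComplex R} (hT : IsTotallyFlatAcyclic T)
    {F : ModuleCat.{u} R} (hF : IsFlat R F) {i j k : ℤ} (hij : i + 1 = j) (hjk : j + 1 = k)
    (g : T.X j ⟶ F) (hg : T.d i j ≫ g = 0) : ∃ h, T.d j k ≫ h = g := by
  have key : ∀ l i j k : ℤ, i = -(l + 1) → j = -l → k = -(l - 1) → ∀ g : T.X j ⟶ F,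
      T.d i j ≫ g = 0 → ∃ h, T.d j k ≫ h = g := by
    rintro l _ _ _ rfl rfl rfl g hg
    exact (hT.hom_exact F hF l g).1 hg
  exact key (-j) i j k (by lia) (by lia) (by lia) g hg

lemma IsTotallyFlatAcyclic.projective_X {T : RComplex R} (hT : IsTotallyFlatAcyclic T) (j : ℤ) :
    Projective (T.X j) := by
  rw [← neg_neg j]
  exact hT.projective (-j)

/-- Exactness of `Hom(T, F)` gives the vanishing of `Ext^1` in every degree `j`; higher Ext follows
by dimension shifting along `T`. -/
lemma IsTotallyFlatAcyclic.flatOrthogonal {T : RComplex R} (hT : IsTotallyFlatAcyclic T) (j : ℤ) :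
    FlatOrthogonal (T.opcycles j) := by
  intro F hF n
  induction n generalizing j with
  | zero =>
    have hS := opcyclesShortComplex_shortExact T (j - 1) j (by simp) (hT.exact _)
    have : Projective (opcyclesShortComplex T (j - 1) j).X₂ := hT.projective_X j
    refine ext_one_eq_zero_of_extension hS fun f => ?_
    let f' : T.opcycles (j - 1) ⟶ F := f
    obtain ⟨h, hh⟩ := hT.exists_extension hF (i := j - 1 - 1) (j := j - 1) (k := j) (by simp)
      (by simp) (T.pOpcycles (j - 1) ≫ f') (by simp)
    refine ⟨h, ?_⟩
    change T.fromOpcycles (j - 1) j ≫ h = f'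
    rw [← cancel_epi (T.pOpcycles (j - 1)), ← hh, T.p_fromOpcycles_assoc]
  | succ n ih =>
    have hS := opcyclesShortComplex_shortExact T (j - 1) j (by simp) (hT.exact _)
    have : Projective (opcyclesShortComplex T (j - 1) j).X₂ := hT.projective_X j
    exact ext_eq_zero_of_shortExact_right hS Abelian.Ext.eq_zero_of_projective (ih (j - 1))

lemma IsTotallyFlatAcyclic.dingCoresolvable {T : RComplex R} (hT : IsTotallyFlatAcyclic T)
    (j : ℤ) : DingCoresolvable (T.opcycles j) := by
  refine ⟨fun N => ∃ j, N = T.opcycles j, ⟨j, rfl⟩, ?_⟩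
  rintro _ ⟨j, rfl⟩
  exact ⟨hT.flatOrthogonal j, _, _, _, _, _,
    opcyclesShortComplex_shortExact T j (j + 1) rfl (hT.exact j), hT.projective_X _, _, rfl⟩

/-- `C_0(X)` is the quotient of `X^0` by the coboundaries. -/
def cokerIsoOpcycles (X : RComplex R) : coker X 0 ≅ X.opcycles 0 :=
  (colimit.isColimit _).coconePointUniqueUpToIso (X.opcyclesIsCokernel (-(0 + 1)) (-0) (by simp))

lemma IsDingProjective.dingCoresolvable {M : ModuleCat.{u} R} (hM : IsDingProjective M) :
    DingCoresolvable M := by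
  obtain ⟨T, hT, ⟨e⟩⟩ := hM
  exact (hT.dingCoresolvable 0).of_iso (e ≪≫ cokerIsoOpcycles T).symm

/-- A coresolution of a module by projective modules with cokernels `DingCoresolvable`. -/
lemma DingCoresolvable.exists_coresolution {M : ModuleCat.{u} R} (hM : DingCoresolvable M) :
    ∃ b : ℕ → ShortComplex (ModuleCat.{u} R), (∀ k, (b k).ShortExact ∧ Projective (b k).X₂ ∧
      DingCoresolvable (b k).X₃) ∧ Nonempty (M ≅ (b 0).X₁) ∧
      ∀ k, Nonempty ((b k).X₃ ≅ (b (k + 1)).X₁) := by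
  choose P N' i p w h hP hN' using
    fun N : {N : ModuleCat.{u} R // DingCoresolvable N} => N.2.exists_shortExact
  let next : {N : ModuleCat.{u} R // DingCoresolvable N} →
    {N : ModuleCat.{u} R // DingCoresolvable N} := fun N => ⟨N' N, hN' N⟩
  refine ⟨fun k => ShortComplex.mk _ _ (w (next^[k] ⟨M, hM⟩)),
    fun k => ⟨h _, hP _, hN' _⟩, ⟨Iso.refl _⟩, fun k => ⟨eqToIso ?_⟩⟩
  exact (congrArg Subtype.val (Function.iterate_succ_apply' next k ⟨M, hM⟩)).symm

lemma flatOrthogonal_opcycles_of_le (P : RComplex R) (m : ℤ) (hP : ∀ j, Projective (P.X j))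
    (hE : ∀ j < m, P.ExactAt j) (hM : FlatOrthogonal (P.opcycles m)) (j : ℤ) (hj : j ≤ m) :
    FlatOrthogonal (P.opcycles j) := by
  induction j, hj using Int.leInductionDown with
  | base => exact hM
  | pred j hj ih =>
    have := hP j
    exact FlatOrthogonal.left
      (opcyclesShortComplex_shortExact P (j - 1) j (by simp) (hE _ (by lia)))
      (FlatOrthogonal.of_projective (P.X j)) ih

/-- A family of morphisms which commutes with the differentials in low degrees can be modified in
high degrees to a morphism of complexes. -/
lemma IsTotallyFlatAcyclic.exists_hom {T P : RComplex R} (hT : IsTotallyFlatAcyclic T)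
    (hP : ∀ j, Projective (P.X j)) (m c : ℤ) [P.IsStrictlyLE c] (φ : ∀ j, T.X j ⟶ P.X j)
    (hφ : ∀ j < m, φ j ≫ P.d j (j + 1) = T.d j (j + 1) ≫ φ (j + 1)) :
    ∃ τ : T ⟶ P, ∀ j ≤ m, τ.f j = φ j := by
  have step : ∀ k : ℕ, ∃ ψ : ∀ j, T.X j ⟶ P.X j, (∀ j ≤ m, ψ j = φ j) ∧
      ∀ j < m + k, ψ j ≫ P.d j (j + 1) = T.d j (j + 1) ≫ ψ (j + 1) := by
    intro k
    induction k with
    | zero => exact ⟨φ, fun _ _ => rfl, fun j hj => hφ j (by simpa using hj)⟩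
    | succ k ih =>
      obtain ⟨ψ, h₁, h₂⟩ := ih
      have := hP (m + k + 1)
      -- `P.X (m + k + 1)` is projective, hence flat, so it may serve as the test module of total
      -- acyclicity.
      obtain ⟨g, hg⟩ := hT.exists_extension (isFlat_of_categorical_projective (P.X (m + k + 1)))
        (i := m + k - 1) (j := m + k) (k := m + k + 1) (by simp) rfl
        (ψ (m + k) ≫ P.d (m + k) (m + k + 1)) (by
          have := h₂ (m + k - 1) (by lia)
          rw [show m + k - 1 + 1 = m + (k : ℤ) by lia] at this
          rw [← reassoc_of% this, P.d_comp_d, comp_zero])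
      refine ⟨Function.update ψ (m + k + 1) g, fun j hj => ?_, fun j hj => ?_⟩
      · rw [Function.update_of_ne (by lia), h₁ j hj]
      · rw [Function.update_of_ne (by lia)]
        by_cases hjk : j = m + k
        · subst hjk
          rw [Function.update_self, hg]
        · rw [Function.update_of_ne (by lia)]
          exact h₂ j (by lia)
  -- Finitely many corrections suffice because `P` vanishes above `c`.
  obtain ⟨ψ, h₁, h₂⟩ := step (c - m).toNat
  refine ⟨{ f := ψ, comm' := ?_ }, h₁⟩
  rintro j _ rfl
  by_cases hj : j < c
  · exact h₂ j (by lia)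
  · exact (P.isZero_of_isStrictlyLE c (j + 1) (by lia)).eq_of_tgt _ _

/-- A bounded above complex `P` of projective modules which is exact in degrees `< m` and such that
`P^m / B^m` is `DingCoresolvable` agrees in degrees `≤ m` with a totally acyclic complex. -/
lemma exists_totallyFlatAcyclic (P : RComplex R) (m c : ℤ) [P.IsStrictlyLE c]
    (hP : ∀ j, Projective (P.X j)) (hE : ∀ j < m, P.ExactAt j)
    (hM : DingCoresolvable (P.opcycles m)) :
    ∃ (T : RComplex R) (τ : T ⟶ P), IsTotallyFlatAcyclic T ∧ ∀ j ≤ m, IsIso (τ.f j) := by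
  obtain ⟨b, hb, ⟨b₀⟩, hb'⟩ := hM.exists_coresolution
  -- Up to degree `m` the pieces come from `P`; above it, from the coresolution of `P^m / B^m`,
  -- whose first term sits in degree `m + 1`.
  let s : ℤ → ShortComplex (ModuleCat.{u} R) := fun j =>
    if j ≤ m then opcyclesShortComplex P (j - 1) j else b (j - m - 1).toNat
  have hs₁ : ∀ j ≤ m, s j = opcyclesShortComplex P (j - 1) j := fun j hj => if_pos hj
  have hs₂ : ∀ j, m < j → s j = b (j - m - 1).toNat := fun j hj => if_neg (by lia)
  have hs : ∀ j, (s j).ShortExact ∧ Projective (s j).X₂ ∧ FlatOrthogonal (s j).X₃ := by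
    intro j
    by_cases hj : j ≤ m
    · rw [hs₁ j hj]
      exact ⟨opcyclesShortComplex_shortExact P _ _ (by simp) (hE _ (by lia)), hP j,
        flatOrthogonal_opcycles_of_le P m hP hE hM.flatOrthogonal j hj⟩
    · rw [hs₂ j (by lia)]
      exact ⟨(hb _).1, (hb _).2.1, (hb _).2.2.flatOrthogonal⟩
  have hs₀ : ∀ j ≤ m, (s j).X₂ = P.X j := fun j hj => by rw [hs₁ j hj]; rfl
  have he : ∀ j, ∃ e : (s j).X₃ ≅ (s (j + 1)).X₁, ∀ hj : j < m,
      (s j).g ≫ e.hom ≫ (s (j + 1)).f = eqToHom (hs₀ j hj.le) ≫ P.d j (j + 1) ≫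
        eqToHom (hs₀ (j + 1) hj).symm := by
    intro j
    rcases lt_trichotomy j m with hj | hj | hj
    · obtain ⟨e, he⟩ := exists_opcyclesShortComplex_iso P j (j + 1 - 1) (j + 1) (by simp) _ _
        (hs₁ j hj.le) (hs₁ (j + 1) hj)
      exact ⟨e, fun _ => he⟩
    · subst hj
      have h₁ := hs₁ j le_rfl
      have h₂ := hs₂ (j + 1) (by lia)
      rw [show (j + 1 - j - 1).toNat = 0 by simp] at h₂
      exact ⟨eqToIso (by rw [h₁]; rfl) ≪≫ b₀ ≪≫ eqToIso (by rw [h₂]),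
        fun h => absurd h (lt_irrefl _)⟩
    · have h₁ := hs₂ j hj
      have h₂ := hs₂ (j + 1) (by lia)
      rw [show (j + 1 - m - 1).toNat = (j - m - 1).toNat + 1 by lia] at h₂
      exact ⟨eqToIso (by rw [h₁]) ≪≫ (hb' _).some ≪≫ eqToIso (by rw [h₂]),
        fun h => absurd h (by lia)⟩
  choose e he using he
  have hT : IsTotallyFlatAcyclic (splice s e) := by
    refine .of_extension (fun j => (hs j).2.1) (splice_acyclic s e fun j => (hs j).1) ?_
    intro F hF
    exact splice_extension s e (fun j => (hs j).1) fun j =>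
      exists_extension_of_ext_one_eq_zero (hs j).1 ((hs j).2.2 F hF 0)
  let φ : ∀ j, (splice s e).X j ⟶ P.X j := fun j =>
    if h : j ≤ m then eqToHom (hs₀ j h) else 0
  have hφ : ∀ (j : ℤ) (h : j ≤ m), φ j = eqToHom (hs₀ j h) := fun j h => dif_pos h
  obtain ⟨τ, hτ⟩ := hT.exists_hom hP m c φ (by
    intro j hj
    rw [hφ j hj.le, hφ (j + 1) hj, splice_d, he j hj]
    erw [Category.assoc, Category.assoc, eqToHom_trans, eqToHom_refl, Category.comp_id])
  refine ⟨splice s e, τ, hT, fun j hj => ?_⟩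
  rw [hτ j hj, hφ j hj]
  exact (eqToIso (hs₀ j hj)).isIso_hom

/-! ### K-projective complexes, resolutions and truncations -/

section KProjective

variable {C : Type*} [Category* C] [Abelian C]

open CochainComplex HomComplex Opposite

/-- A degree `n` cohomology class is a homotopy class of maps from `P` to the shift of `E` by `n`,
which is still acyclic. -/
lemma homComplex_acyclic_of_isKProjective (P E : CochainComplex C ℤ) [P.IsKProjective]
    (hE : E.Acyclic) : (HomComplex P E).Acyclic := by
  intro n
  rw [HomologicalComplex.exactAt_iff_isZero_homology]
  have hz : ∀ x : CohomologyClass P E n, x = 0 := by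
    intro x
    refine (CohomologyClass.toHom_bijective P E n).1 ?_
    rw [map_zero]
    refine IsKProjective.leftOrthogonal P _ ?_
    rw [HomotopyCategory.quotient_obj_mem_subcategoryAcyclic_iff_acyclic]
    have h := (HomotopyCategory.subcategoryAcyclic C).le_shift n _
      ((HomotopyCategory.quotient_obj_mem_subcategoryAcyclic_iff_acyclic E).2 hE)
    rw [← HomotopyCategory.quotient_obj_mem_subcategoryAcyclic_iff_acyclic]
    exact ObjectProperty.prop_of_iso _
      (((HomotopyCategory.quotient C (.up ℤ)).commShiftIso n).symm.app E) h
  have : Subsingleton (CohomologyClass P E n) := ⟨fun x y => by rw [hz x, hz y]⟩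
  have : Subsingleton ((HomComplex P E).homology n) :=
    (homologyAddEquiv P E n).injective.subsingleton (β := CohomologyClass P E n)
  exact AddCommGrpCat.isZero_of_subsingleton _

lemma isKProjective_of_homComplex_acyclic (P : CochainComplex C ℤ)
    (h : ∀ E : CochainComplex C ℤ, E.Acyclic → (HomComplex P E).Acyclic) :
    P.IsKProjective where
  nonempty_homotopy_zero {E} f hE := by
    have hz := (h E hE 0).isZero_homology
    have : Subsingleton ((HomComplex P E).homology 0) :=
      AddCommGrpCat.subsingleton_of_isZero hz
    have : Subsingleton (CohomologyClass P E 0) :=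
      (homologyAddEquiv P E 0).symm.injective.subsingleton
    obtain ⟨β, hβ⟩ := (mem_coboundaries_iff (Cocycle.ofHom f) (-1) (by simp)).1
      ((CohomologyClass.mk_eq_zero_iff _).1 (Subsingleton.elim _ _))
    exact ⟨(Cochain.equivHomotopy f 0).symm ⟨β, by simpa using hβ.symm⟩⟩

attribute [local instance] HasDerivedCategory.standard in
/-- Morphisms from a K-projective complex lift along quasi-isomorphisms, up to homotopy. -/
lemma exists_lift_of_quasiIso {P A B : CochainComplex C ℤ} [P.IsKProjective] (f : A ⟶ B)
    [QuasiIso f] (π : P ⟶ B) : ∃ g : P ⟶ A, Nonempty (Homotopy (g ≫ f) π) := by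
  obtain ⟨g, hg⟩ := (IsKProjective.Qh_map_bijective P _).surjective
    ((DerivedCategory.quotientCompQhIso C).hom.app P ≫ DerivedCategory.Q.map π ≫
      inv (DerivedCategory.Q.map f) ≫ (DerivedCategory.quotientCompQhIso C).inv.app A)
  obtain ⟨g, rfl⟩ := (HomotopyCategory.quotient _ _).map_surjective g
  refine ⟨g, ⟨HomotopyCategory.homotopyOfEq _ _
    ((IsKProjective.Qh_map_bijective P _).injective ?_)⟩⟩
  rw [Functor.map_comp, Functor.map_comp, hg]
  simp only [Category.assoc, ← DerivedCategory.quotientCompQhIso_inv_naturality,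
    IsIso.inv_hom_id_assoc]
  exact NatIso.naturality_2 (DerivedCategory.quotientCompQhIso C) π

lemma exists_quasiIso_lift {P A B : CochainComplex C ℤ} [P.IsKProjective] (f : A ⟶ B)
    [QuasiIso f] (π : P ⟶ B) [QuasiIso π] : ∃ g : P ⟶ A, QuasiIso g := by
  obtain ⟨g, ⟨h⟩⟩ := exists_lift_of_quasiIso f π
  refine ⟨g, ?_⟩
  have : QuasiIso (g ≫ f) := by
    rw [quasiIso_iff]
    intro i
    rw [quasiIsoAt_iff_isIso_homologyMap, h.homologyMap_eq i]
    infer_instance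
  exact quasiIso_of_comp_right g f

lemma quasiIso_of_opEquivalence {K L : CochainComplex C ℤ} (f : K ⟶ L)
    (h : QuasiIso ((CochainComplex.opEquivalence C).functor.map f.op)) : QuasiIso f := by
  rw [quasiIso_iff]
  intro n
  obtain ⟨m, rfl⟩ : ∃ m, n = -m := ⟨-n, by simp⟩
  have hm := (quasiIso_iff _).1 h m
  rw [← HomologicalComplex.quasiIsoAt_opFunctor_map_iff]
  rw [quasiIsoAt_iff' _ (m - 1) m (m + 1) (by simp) (by simp)] at hm
  rw [quasiIsoAt_iff' _ (-(m - 1)) (-m) (-(m + 1))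
    (ComplexShape.prev_eq' _ (show -m + 1 = -(m - 1) by ring))
    (ComplexShape.next_eq' _ (show -(m + 1) + 1 = -m by ring))]
  exact hm

/-- A bounded above complex admits a quasi-isomorphism from a bounded above complex of projective
objects. -/
lemma exists_quasiIso_projective [EnoughProjectives C] (K : CochainComplex C ℤ) (n : ℤ)
    [K.IsStrictlyLE n] : ∃ (P : CochainComplex C ℤ) (f : P ⟶ K), QuasiIso f ∧
      (∀ j, Projective (P.X j)) ∧ P.IsStrictlyLE n := by
  -- By duality this is an injective resolution of a bounded below complex in the opposite category.
  let F := (CochainComplex.opEquivalence C).functor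
  have : (F.obj (op K)).IsStrictlyGE (-n) := by
    rw [isStrictlyGE_iff]
    intro i hi
    exact (K.isZero_of_isStrictlyLE n (-i) (by lia)).op
  obtain ⟨I, i, hi, hI, hI'⟩ :=
    CochainComplex.Plus.modelCategoryQuillen.exists_quasiIso_injective (F.obj (op K)) (-n)
  let P := (F.objPreimage I).unop
  let e : F.obj (op P) ≅ I := F.objObjPreimageIso I
  obtain ⟨f, hf⟩ : ∃ f : P ⟶ K, F.map f.op = i ≫ e.inv :=
    ⟨(F.preimage (i ≫ e.inv)).unop, F.map_preimage (i ≫ e.inv)⟩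
  refine ⟨P, f, quasiIso_of_opEquivalence f ?_, fun j => ?_, ?_⟩
  · change QuasiIso (F.map f.op)
    rw [hf]
    infer_instance
  · obtain ⟨m, rfl⟩ : ∃ m, j = -m := ⟨-j, by simp⟩
    have : Injective (Opposite.op (P.X (-m))) := Injective.of_iso
      ((HomologicalComplex.eval _ _ m).mapIso e).symm (hI m)
    exact Injective.projective_iff_injective_op.2 this
  · rw [isStrictlyLE_iff]
    intro j hj
    obtain ⟨m, rfl⟩ : ∃ m, j = -m := ⟨-j, by simp⟩
    exact ((I.isZero_of_isStrictlyGE (-n) m (by lia)).of_iso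
      ((HomologicalComplex.eval _ _ m).mapIso e)).unop

lemma mappingCone_acyclic {K L : CochainComplex C ℤ} (f : K ⟶ L) [hf : QuasiIso f] :
    (mappingCone f).Acyclic := by
  rw [← HomotopyCategory.quotient_obj_mem_subcategoryAcyclic_iff_acyclic]
  refine ((HomotopyCategory.subcategoryAcyclic C).trW_iff_of_distinguished _
    (HomotopyCategory.mappingCone_triangleh_distinguished f)).1 ?_
  rw [← HomotopyCategory.quasiIso_eq_trW_subcategoryAcyclic]
  exact (HomotopyCategory.quotient_map_mem_quasiIso_iff f).2 hf

lemma isIso_πTruncGE_f (K : CochainComplex C ℤ) (n j : ℤ) (hj : n < j) :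
    IsIso ((K.πTruncGE n).f j) := by
  obtain ⟨k, rfl⟩ := Int.le.dest hj.le
  refine (ComplexShape.Embedding.isIso_liftExtend_f_iff (ComplexShape.embeddingUpIntGE n) _
    (HomologicalComplex.restrictionToTruncGE'_hasLift _ _)
    (i := k) (by simp)).2 (HomologicalComplex.isIso_restrictionToTruncGE' _ _ _ ?_)
  rw [ComplexShape.boundaryGE_embeddingUpIntGE_iff]
  lia

lemma isIso_ιTruncLE_f (K : CochainComplex C ℤ) (n j : ℤ) (hj : j < n) :
    IsIso ((K.ιTruncLE n).f j) := by
  obtain ⟨k, rfl⟩ : ∃ k : ℕ, j = n - k := ⟨(n - j).toNat, by lia⟩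
  have h : IsIso ((HomologicalComplex.πTruncGE (HomologicalComplex.op K)
      (ComplexShape.embeddingUpIntLE n).op).f (n - k)) := by
    refine (ComplexShape.Embedding.isIso_liftExtend_f_iff (ComplexShape.embeddingUpIntLE n).op _
      (HomologicalComplex.restrictionToTruncGE'_hasLift _ _)
      (i := k) (by simp)).2 (HomologicalComplex.isIso_restrictionToTruncGE' _ _ _ ?_)
    rw [ComplexShape.Embedding.op_boundaryGE_iff, ComplexShape.boundaryLE_embeddingUpIntLE_iff]
    lia
  exact inferInstanceAs (IsIso ((HomologicalComplex.πTruncGE (HomologicalComplex.op K)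
      (ComplexShape.embeddingUpIntLE n).op).f (n - k)).unop)

/-- If a K-projective complex of projective objects is exact in degrees `> a`, its cycles in
degrees `> a + 2` are projective. -/
lemma projective_cycles (P : CochainComplex C ℤ) [P.IsKProjective]
    (hP : ∀ j, Projective (P.X j)) (a : ℤ) [P.IsLE a] (c : ℤ) (hc : a + 2 < c) :
    Projective (P.cycles c) := by
  have hE : (P.truncGE (a + 1)).Acyclic := (P.acyclic_truncGE_iff a (a + 1)).2 inferInstance
  let h := IsKProjective.homotopyZero (P.πTruncGE (a + 1)) hE
  have h₁ := isIso_πTruncGE_f P (a + 1) (c - 1) (by lia)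
  have h₂ := isIso_πTruncGE_f P (a + 1) c (by lia)
  have hcomm := h.comm c
  rw [dNext_eq h.hom (show (ComplexShape.up ℤ).Rel c (c + 1) by simp),
    prevD_eq h.hom (show (ComplexShape.up ℤ).Rel (c - 1) c by simp)] at hcomm
  -- The projection to the acyclic `P.truncGE (a + 1)` is null-homotopic, and it is invertible in
  -- degrees `c - 1` and `c` because `a + 1 < c - 1`. The homotopy thus splits `P.X (c - 1) ⟶
  -- P.cycles c`.
  let s : P.cycles c ⟶ P.X (c - 1) :=
    P.iCycles c ≫ h.hom c (c - 1) ≫ inv ((P.πTruncGE (a + 1)).f (c - 1))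
  have hs : s ≫ P.toCycles (c - 1) c = 𝟙 _ := by
    rw [← cancel_mono (P.iCycles c), ← cancel_mono ((P.πTruncGE (a + 1)).f c)]
    have hc' : P.iCycles c ≫ (P.πTruncGE (a + 1)).f c =
        P.iCycles c ≫ h.hom c (c - 1) ≫ (P.truncGE (a + 1)).d (c - 1) c := by
      rw [hcomm]
      simp
    simp only [s, Category.assoc, HomologicalComplex.toCycles_i_assoc,
      ← HomologicalComplex.Hom.comm, IsIso.inv_hom_id_assoc, Category.id_comp]
    exact hc'.symm
  have := hP (c - 1)
  exact Retract.projective ⟨s, P.toCycles (c - 1) c, hs⟩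

end KProjective

lemma IsDGProjective.isKProjective {P : RComplex R} (hP : IsDGProjective P) : P.IsKProjective :=
  isKProjective_of_homComplex_acyclic P hP.2

lemma IsDGProjective.projective_X {P : RComplex R} (hP : IsDGProjective P) (j : ℤ) :
    Projective (P.X j) := by
  rw [← neg_neg j]
  exact hP.1 (-j)

lemma IsDGProjective.of_isStrictlyLE (P : RComplex R) (c : ℤ) [P.IsStrictlyLE c]
    (hP : ∀ j, Projective (P.X j)) : IsDGProjective P :=
  ⟨fun _ => hP _, fun E hE =>
    have := CochainComplex.isKProjective_of_projective P c
    homComplex_acyclic_of_isKProjective P E hE⟩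

/-- Quasi-isomorphisms out of `P` lift through quasi-isomorphisms up to homotopy. The `iff` form
makes the reversed arrows of a zigzag harmless. -/
lemma QIsoEquiv.exists_quasiIso_iff {A B : RComplex R} (h : QIsoEquiv A B) (P : RComplex R)
    [P.IsKProjective] : (∃ f : P ⟶ A, QuasiIso f) ↔ ∃ f : P ⟶ B, QuasiIso f := by
  induction h with
  | rel A B h =>
    obtain ⟨f, hf⟩ := h
    exact ⟨fun ⟨g, hg⟩ => ⟨g ≫ f, inferInstance⟩, fun ⟨g, hg⟩ => exists_quasiIso_lift f g⟩
  | refl A => rfl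
  | symm A B _ ih => exact ih.symm
  | trans A B C _ _ ih₁ ih₂ => exact ih₁.trans ih₂

/-! ### Mapping cones of resolutions and the two constructions -/

section MappingCone

variable {C : Type*} [Category* C] [Abelian C]

open CochainComplex

/-- If `L^i = 0`, the modules `K^j / B^j` and `M^i / B^i` agree, where `M` is the mapping cone of
`f : K ⟶ L` and `j = i + 1`. -/
def opcyclesIsoMappingCone {K L : CochainComplex C ℤ} (f : K ⟶ L) (i j : ℤ) (hij : i + 1 = j)
    (hL : IsZero (L.X i)) : K.opcycles j ≅ (mappingCone f).opcycles i where
  hom := K.descOpcycles ((mappingCone.inl f).v j i (by lia) ≫ (mappingCone f).pOpcycles i) i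
    (by simp [← hij]) (by
      have h := mappingCone.inl_v_d f i (i - 1) j (by lia) (by lia)
      rw [hL.eq_of_tgt (f.f i) 0, zero_comp, zero_sub] at h
      rw [← Category.assoc, ← neg_eq_iff_eq_neg.2 h]
      simp)
  inv := (mappingCone f).descOpcycles ((mappingCone.fst f).1.v i j hij ≫ K.pOpcycles j) (i - 1)
    (by simp) (by simp [mappingCone.d_fst_v_assoc f (i - 1) i j (by lia) hij])
  hom_inv_id := by
    rw [← cancel_epi (K.pOpcycles j)]
    simp
  inv_hom_id := by
    rw [← cancel_epi ((mappingCone f).pOpcycles i)]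
    have h := mappingCone.id_X f i j hij
    rw [hL.eq_of_tgt ((mappingCone.snd f).v i i (add_zero i)) 0, zero_comp, add_zero] at h
    simp [reassoc_of% h]

end MappingCone

/-- Descending induction from degree `c + 1`, where the complex is zero, by closure under kernels of
epimorphisms. -/
lemma dingCoresolvable_opcycles_of_acyclic (K : RComplex R) (hK : K.Acyclic) (c : ℤ)
    [K.IsStrictlyLE c] (h : ∀ j, DingCoresolvable (K.X j)) (j : ℤ) :
    DingCoresolvable (K.opcycles j) := by
  have hz : ∀ j, c < j → DingCoresolvable (K.opcycles j) := fun j hj =>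
    .of_isZero (IsZero.of_epi (K.pOpcycles j) (K.isZero_of_isStrictlyLE c j hj))
  by_cases hj : c < j
  · exact hz j hj
  · have hj' : j ≤ c + 1 := by lia
    clear hj
    induction j, hj' using Int.leInductionDown with
    | base => exact hz _ (by lia)
    | pred j hj ih =>
      exact DingCoresolvable.left (opcyclesShortComplex_shortExact K (j - 1) j (by simp) (hK _))
        (h j) ih

lemma dingCoresolvable_opcycles_of_quasiIso {P Q : RComplex R} (f : P ⟶ Q) [QuasiIso f] (c : ℤ)
    [P.IsStrictlyLE c] [Q.IsStrictlyLE c] (hP : ∀ j, Projective (P.X j))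
    (hQ : ∀ j, DingCoresolvable (Q.X j)) (m : ℤ) (hm : IsZero (Q.X (m - 1))) :
    DingCoresolvable (P.opcycles m) := by
  have hLE : (CochainComplex.mappingCone f).IsStrictlyLE c := by
    rw [CochainComplex.isStrictlyLE_iff]
    intro i hi
    rw [CochainComplex.mappingCone.isZero_X_iff]
    exact ⟨P.isZero_of_isStrictlyLE c _ (by lia), Q.isZero_of_isStrictlyLE c _ hi⟩
  refine (dingCoresolvable_opcycles_of_acyclic _ (mappingCone_acyclic f) c (fun j => ?_)
    (m - 1)).of_iso (opcyclesIsoMappingCone f (m - 1) m (by simp) hm).symm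
  have := hP (j + 1)
  exact (DingCoresolvable.biprod (.of_projective (P.X (j + 1))) (hQ j)).of_iso
    (HomologicalComplex.homotopyCofiber.XIsoBiprod f j (j + 1) rfl).symm

lemma exactAt_of_quasiIso_of_isZero {P Q : RComplex R} (f : P ⟶ Q) [QuasiIso f] (j : ℤ)
    (h : IsZero (Q.X j)) : P.ExactAt j :=
  (quasiIsoAt_iff_exactAt' f j (ShortComplex.exact_of_isZero_X₂ (Q.sc j) h)).1 inferInstance

/-- A projective resolution of `M`, spliced with its coresolution, is the required totally acyclic
complex. -/
lemma DingCoresolvable.isDingProjective {M : ModuleCat.{u} R} (hM : DingCoresolvable M) :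
    IsDingProjective M := by
  let K : RComplex R := (HomologicalComplex.single _ _ 0).obj M
  obtain ⟨P, f, hf, hP, _⟩ := exists_quasiIso_projective K 0
  have h₀ : IsIso (P.homologyι 0) := P.isIso_homologyι 0 1 (by simp)
    ((P.isZero_of_isStrictlyLE 0 1).eq_of_tgt _ _)
  let e : P.opcycles 0 ≅ M := (asIso (P.homologyι 0)).symm ≪≫
    asIso (HomologicalComplex.homologyMap f 0) ≪≫
    HomologicalComplex.singleObjHomologySelfIso _ 0 M
  obtain ⟨T, τ, hT, hτ⟩ := exists_totallyFlatAcyclic P 0 0 hP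
    (fun j hj => exactAt_of_quasiIso_of_isZero f j (K.isZero_of_isStrictlyGE 0 j hj))
    (hM.of_iso e.symm)
  have := hτ (-1) (by simp)
  have := hτ 0 le_rfl
  have := isIso_opcyclesMap τ (-1) 0 (by simp)
  exact ⟨T, hT, ⟨(cokerIsoOpcycles T ≪≫ asIso (HomologicalComplex.opcyclesMap τ 0) ≪≫ e).symm⟩⟩

lemma isDingProjective_iff (M : ModuleCat.{u} R) : IsDingProjective M ↔ DingCoresolvable M :=
  ⟨fun h => h.dingCoresolvable, fun h => h.isDingProjective⟩

/-- A bounded complex of Ding projective modules gives rise to complete resolutions. -/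
lemma exists_flatCompleteResolution {Q X : RComplex R} (h : QIsoEquiv Q X) (c : ℤ)
    [Q.IsStrictlyLE c] (hQ : ∀ j, IsDingProjective (Q.X j)) (m : ℤ)
    (hm : ∀ j < m, IsZero (Q.X j)) :
    ∃ (T P : RComplex R) (τ : T ⟶ P) (π : P ⟶ X), IsFlatCompleteResolution τ π ∧
      ∀ j ≤ m, IsIso (τ.f j) := by
  obtain ⟨P, f, hf, hP, hc⟩ := exists_quasiIso_projective Q c
  have hDG := IsDGProjective.of_isStrictlyLE P c hP
  have := hDG.isKProjective
  obtain ⟨π, hπ⟩ := (h.exists_quasiIso_iff P).1 ⟨f, hf⟩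
  obtain ⟨T, τ, hT, hτ⟩ := exists_totallyFlatAcyclic P m c hP
    (fun j hj => exactAt_of_quasiIso_of_isZero f j (hm j hj))
    (dingCoresolvable_opcycles_of_quasiIso f c hP (fun j => (hQ j).dingCoresolvable) m
      (hm _ (by simp)))
  refine ⟨T, P, τ, π, ⟨hDG, hπ, hT, -m, fun i hi => ?_⟩, hτ⟩
  have := hτ (-i) (by lia)
  exact ConcreteCategory.bijective_of_isIso (τ.f (-i))

lemma exactAt_of_isIso {T P : RComplex R} (τ : T ⟶ P) (hT : T.Acyclic) (m : ℤ)
    (hτ : ∀ j ≤ m, IsIso (τ.f j)) (j : ℤ) (hj : j < m) : P.ExactAt j := by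
  rw [HomologicalComplex.exactAt_iff' _ (j - 1) j (j + 1) (by simp) (by simp)]
  have hj' := hT j
  rw [HomologicalComplex.exactAt_iff' _ (j - 1) j (j + 1) (by simp) (by simp)] at hj'
  have h₁ := hτ (j - 1) (by lia)
  have h₂ := hτ j (by lia)
  have h₃ := hτ (j + 1) (by lia)
  let e₁ : T.X (j - 1) ≅ P.X (j - 1) := asIso (τ.f (j - 1))
  let e₂ : T.X j ≅ P.X j := asIso (τ.f j)
  let e₃ : T.X (j + 1) ≅ P.X (j + 1) := asIso (τ.f (j + 1))
  exact (ShortComplex.exact_iff_of_iso (ShortComplex.isoMk (S₁ := T.sc' (j - 1) j (j + 1))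
    (S₂ := P.sc' (j - 1) j (j + 1)) e₁ e₂ e₃ (τ.comm _ _) (τ.comm _ _))).1 hj'

/-- A complete resolution of a homologically bounded complex gives rise to a bounded complex of
Ding projective modules. -/
lemma exists_isDingProjective_of_flatCompleteResolution {T P X : RComplex R} {τ : T ⟶ P}
    {π : P ⟶ X} (h : IsFlatCompleteResolution τ π) (a : ℤ) (hX : ∀ j, a < j → X.ExactAt j)
    (m : ℤ) (hτ : ∀ j ≤ m, IsIso (τ.f j)) :
    ∃ (Q : RComplex R) (c : ℤ), QIsoEquiv Q X ∧ (∀ j, c < j → IsZero (Q.X j)) ∧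
      (∀ j, IsDingProjective (Q.X j)) ∧ ∀ j < m, IsZero (Q.X j) := by
  have := h.quasiIso
  have := h.dgProjective.isKProjective
  have hP := h.dgProjective.projective_X
  have hLE : P.IsLE a := by
    rw [CochainComplex.isLE_iff]
    exact fun j hj => (quasiIsoAt_iff_exactAt' π j (hX j hj)).1 inferInstance
  -- `a + 3` makes the cycles in degree `c` projective; `m + 1` keeps degrees `m - 1` and `m`
  -- untouched by the truncation.
  let c : ℤ := max (a + 3) (m + 1)
  have hac : a ≤ c := by lia
  have hcyc := projective_cycles P hP a c (by lia)
  have : P.IsLE c := P.isLE_of_le a c hac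
  let P' : RComplex R := P.truncLE c
  have hP' : ∀ j, Projective (P'.X j) := by
    intro j
    rcases lt_trichotomy j c with hj | rfl | hj
    · exact Projective.of_iso (P.truncLEXIso c j hj).symm (hP j)
    · exact Projective.of_iso (P.truncLEXIsoCycles c).symm hcyc
    · exact (P'.isZero_of_isStrictlyLE c j hj).projective
  have hGE : P'.IsGE m := by
    rw [CochainComplex.isGE_iff]
    exact fun j hj => (quasiIsoAt_iff_exactAt' (P.ιTruncLE c) j
      (exactAt_of_isIso τ h.totallyAcyclic.exact m hτ j hj)).1 inferInstance
  have hop : DingCoresolvable (P'.opcycles m) := by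
    have := isIso_ιTruncLE_f P c (m - 1) (by lia)
    have := isIso_ιTruncLE_f P c m (by lia)
    have := isIso_opcyclesMap (P.ιTruncLE c) (m - 1) m (by simp)
    have := hτ (m - 1) (by lia)
    have := hτ m le_rfl
    have := isIso_opcyclesMap τ (m - 1) m (by simp)
    exact (h.totallyAcyclic.dingCoresolvable m).of_iso
      (asIso (HomologicalComplex.opcyclesMap τ m) ≪≫
        (asIso (HomologicalComplex.opcyclesMap (P.ιTruncLE c) m)).symm)
  -- This truncation has `P'^m / B^m` in degree `m`, projectives above and zero below.
  refine ⟨P'.truncGE m, c, ?_, ?_, ?_, ?_⟩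
  · refine .trans _ P' _ (.symm _ _ (.rel _ _ ⟨P'.πTruncGE m, inferInstance⟩)) ?_
    exact .rel _ _ ⟨P.ιTruncLE c ≫ π, inferInstance⟩
  · intro j hj
    exact (P'.truncGE m).isZero_of_isStrictlyLE c j hj
  · intro j
    rw [isDingProjective_iff]
    have := hP' j
    rcases lt_trichotomy m j with hj | rfl | hj
    · exact (DingCoresolvable.of_projective (P'.X j)).of_iso (P'.truncGEXIso m j hj).symm
    · exact hop.of_iso (P'.truncGEXIsoOpcycles m).symm
    · exact .of_isZero ((P'.truncGE m).isZero_of_isStrictlyGE m j hj)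
  · intro j hj
    exact (P'.truncGE m).isZero_of_isStrictlyGE m j hj

/-! ### Comparison of extended integers -/

lemma supDegree_le_iff (Q : RComplex R) (n : ℤ) :
    supDegree Q ≤ ofInt n ↔ ∀ j < -n, IsZero (Q.X j) := by
  rw [supDegree, sSup_le_iff]
  constructor
  · intro h j hj
    by_contra hj'
    have := h _ ⟨-j, by simpa [comp] using hj', rfl⟩
    simp only [WithBot.coe_le_coe, WithTop.coe_le_coe] at this
    lia
  · rintro h _ ⟨l, hl, rfl⟩
    simp only [WithBot.coe_le_coe, WithTop.coe_le_coe]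
    by_contra hln
    exact hl (h (-l) (by lia))

/-- This also covers `b = -∞`, the supremum for a zero complex: there `a` lies below every integer.
-/
lemma extInt_le_of_forall_ofInt {a b : ExtInt} (h : ∀ n : ℤ, b ≤ ofInt n → a ≤ ofInt n) :
    a ≤ b := by
  induction b using WithBot.recBotCoe with
  | bot =>
    induction a using WithBot.recBotCoe with
    | bot => exact le_rfl
    | coe a =>
      induction a using WithTop.recTopCoe with
      | top => simpa using h 0 bot_le
      | coe a =>
        have := h (a - 1) bot_le
        simp only [WithBot.coe_le_coe, WithTop.coe_le_coe] at this
        lia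
  | coe b =>
    induction b using WithTop.recTopCoe with
    | top => exact le_top
    | coe b => exact h b le_rfl

lemma forall_bijective_compMap_iff {T P : RComplex R} (τ : T ⟶ P) (n : ℤ) :
    (∀ i ≥ n, Function.Bijective (compMap τ i)) ↔ ∀ j ≤ -n, IsIso (τ.f j) := by
  constructor
  · intro h j hj
    obtain ⟨i, rfl⟩ : ∃ i, j = -i := ⟨-j, by simp⟩
    exact (ConcreteCategory.isIso_iff_bijective _).2 (h i (by lia))
  · intro h i hi
    have := h (-i) (by lia)
    exact ConcreteCategory.bijective_of_isIso (τ.f (-i))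

end DingProj
end

theorem mainTheorem2 {R : Type u} [Ring R] (X : DingProj.RComplex R)
    (hX : DingProj.IsHomologicallyBoundedBelow X) :
    DingProj.Dpd X =
      sInf {s : DingProj.ExtInt | ∃ Q : DingProj.RComplex R,
        DingProj.QIsoEquiv Q X ∧ DingProj.IsBoundedBelow Q ∧
          (∀ l : ℤ, DingProj.IsDingProjective (DingProj.comp Q l)) ∧
          s = DingProj.supDegree Q} := by
  apply le_antisymm
  · refine le_sInf ?_
    rintro _ ⟨Q, hQX, ⟨b, hb⟩, hQ, rfl⟩
    refine DingProj.extInt_le_of_forall_ofInt fun n hn => sInf_le ⟨n, ?_, rfl⟩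
    have hc : Q.IsStrictlyLE (-b) := by
      rw [CochainComplex.isStrictlyLE_iff]
      intro j hj
      have := hb (-j) (by lia)
      rwa [DingProj.comp, neg_neg] at this
    obtain ⟨T, P, τ, π, h, hτ⟩ := DingProj.exists_flatCompleteResolution hQX (-b)
      (fun j => by simpa only [DingProj.comp, neg_neg] using hQ (-j)) (-n)
      ((DingProj.supDegree_le_iff Q n).1 hn)
    exact ⟨T, P, τ, π, h, (DingProj.forall_bijective_compMap_iff τ n).2 hτ⟩
  · refine le_sInf ?_
    rintro _ ⟨n, ⟨T, P, τ, π, h, hτ⟩, rfl⟩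
    obtain ⟨b, hb⟩ := hX
    obtain ⟨Q, c, hQX, hc, hQ, hm⟩ :=
      DingProj.exists_isDingProjective_of_flatCompleteResolution h (-b) (fun j hj => by
        rw [HomologicalComplex.exactAt_iff_isZero_homology]
        obtain ⟨l, rfl⟩ : ∃ l, j = -l := ⟨-j, by simp⟩
        exact hb l (by lia)) (-n)
        ((DingProj.forall_bijective_compMap_iff τ n).1 hτ)
    exact le_trans (sInf_le ⟨Q, hQX, ⟨-c, fun l hl => hc (-l) (by lia)⟩, fun l => hQ (-l), rfl⟩)
      ((DingProj.supDegree_le_iff Q n).2 hm)
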